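/- Let $(N,h)$ be a connected Riemannian spin manifold of dimension $n$ with Levi-Civita connection $\nabla^N$, and let $\Sigma N\to N$ be its complex spinor bundle, with Hermitian product $\langle\cdot,\cdot\rangle$ (complex linear in the first argument, $\|\varphi\|^2=\langle\varphi,\varphi\rangle$), with Clifford multiplication $X\otimes\varphi\mapsto X\cdot\varphi$ satisfying $X\cdot X\cdot\varphi=-h(X,X)\varphi$ and $\langle X\cdot\varphi,\psi\rangle=-\langle\varphi,X\cdot\psi\rangle$, and with the connection induced by $\nabla^N$. Let $\varphi\in\Gamma(\Sigma N)$ be a smooth spinor field, let $U_\varphi$ be its Dirac current, i.e. the vector field defined by $$h(U_\varphi,X)=-i\,\langle X\cdot\varphi,\varphi\rangle\qquad\text{for all }X\in TN,$$ let $W\in\Gamma(\mathrm{End}(TN))$ be a smooth field of endomorphisms (not necessarily symmetric), with pointwise adjoint $W^T$ with respect to $h$, and let $u\in C^\infty(N)$ be a real-valued function. Assume that $$\nabla^N_X\varphi=\tfrac i2\,W(X)\cdot\varphi\quad\text{for all }X\in TN,\qquad\text{and}\qquad U_\varphi\cdot\varphi=i\,u\,\varphi.$$ Then $\mathrm{grad}\langle\varphi,\varphi\rangle=-W^T(U_\varphi)$.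 If $U_\varphi\equiv0$, then $\|\varphi\|$ is constant. If $U_\varphi\not\equiv0$, then $U_\varphi$ and $\varphi$ vanish nowhere and $u=\|U_\varphi\|=\langle\varphi,\varphi\rangle=\|\varphi\|^2$ on all of $N$. -/

import Mathlib

open Bundle Manifold
open scoped ContDiff

noncomputable section

/-! ### Linear algebra: the Clifford algebra of Euclidean space and its spinor modules -/

/-- The quadratic form `v ↦ -|v|²` on `ℝⁿ`.  Its Clifford algebra obeys `v · v = -|v|²`, and
`spinGroup (euclideanForm n)` is the group `Spin(n)`. -/
def euclideanForm (n : ℕ) : QuadraticForm ℝ (EuclideanSpace ℝ (Fin n)) :=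
  LinearMap.BilinMap.toQuadraticMap (-(innerₗ (EuclideanSpace ℝ (Fin n))))

theorem euclideanForm_apply (n : ℕ) (v : EuclideanSpace ℝ (Fin n)) :
    euclideanForm n v = -‖v‖ ^ 2 := by
  simp [euclideanForm, LinearMap.BilinMap.toQuadraticMap_apply]

/-- The vector `v ∈ ℝⁿ` as an element of the Clifford algebra. -/
abbrev cliffordVec {n : ℕ} (v : EuclideanSpace ℝ (Fin n)) : CliffordAlgebra (euclideanForm n) :=
  CliffordAlgebra.ι (euclideanForm n) v

/-- A spinor module `Σₙ`: an irreducible complex representation of the Clifford algebra of `ℝⁿ` on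
a finite-dimensional Hermitian space `S`, on which vectors act by skew-Hermitian maps.
(An algebra map over `ℝ` into `End_ℂ S` is the same as a representation of the complexified
Clifford algebra.) -/
structure SpinorModule (n : ℕ) (S : Type*) [NormedAddCommGroup S] [InnerProductSpace ℂ S]
    [FiniteDimensional ℂ S] where
  /-- the representation -/
  rep : CliffordAlgebra (euclideanForm n) →ₐ[ℝ] Module.End ℂ S
  skew : ∀ (v : EuclideanSpace ℝ (Fin n)) (s t : S),
    inner ℂ (rep (cliffordVec v) s) t = -inner ℂ s (rep (cliffordVec v) t)
  nontrivial : Nontrivial S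
  irreducible : ∀ V : Submodule ℂ S,
    (∀ (v : EuclideanSpace ℝ (Fin n)), ∀ s ∈ V, rep (cliffordVec v) s ∈ V) → V = ⊥ ∨ V = ⊤

/-- An endomorphism of the complex vector space `S`, as a real-linear continuous map. -/
def endToRealCLM (S : Type*) [NormedAddCommGroup S] [InnerProductSpace ℂ S]
    [FiniteDimensional ℂ S] : Module.End ℂ S →ₗ[ℝ] (S →L[ℝ] S) where
  toFun f := (LinearMap.toContinuousLinearMap f).restrictScalars ℝ
  map_add' _ _ := rfl
  map_smul' _ _ := rfl

@[simp]
theorem endToRealCLM_apply {S : Type*} [NormedAddCommGroup S] [InnerProductSpace ℂ S]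
    [FiniteDimensional ℂ S] (f : Module.End ℂ S) (s : S) : endToRealCLM S f s = f s := rfl

/-! ### Spin structures -/

section Spin

variable {n : ℕ} {N : Type*} [TopologicalSpace N] [ChartedSpace (EuclideanSpace ℝ (Fin n)) N]
  [IsManifold (𝓡 n) ∞ N] [RiemannianBundle (fun x : N ↦ TangentSpace (𝓡 n) x)]

/-- The coordinates `(h(X, e₁), …, h(X, eₙ)) ∈ ℝⁿ` of a tangent vector `X` in an orthonormal
frame `e` at a point. -/
def frameCoord {x : N} (e : Fin n → TangentSpace (𝓡 n) x) (X : TangentSpace (𝓡 n) x) :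
    EuclideanSpace ℝ (Fin n) :=
  WithLp.toLp 2 fun i ↦ inner ℝ (e i) X

variable (n N) in
/-- A spin structure on the Riemannian manifold `N`, in terms of transition functions:
an open cover `dom a` with smooth orthonormal frames `frame a` (those which define the orientation),
and smooth lifts `lift a b : dom a ∩ dom b → Spin(n)` of the transition functions between these
frames, along the double covering `Spin(n) → SO(n)`, `g ↦ (v ↦ g v g⁻¹)`, such that the lifts
satisfy the cocycle condition. -/
structure SpinStructure (ι : Type*) where
  dom : ι → Set N
  isOpen_dom : ∀ a, IsOpen (dom a)
  covers : ∀ x, ∃ a, x ∈ dom a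
  frame : ι → Fin n → (x : N) → TangentSpace (𝓡 n) x
  frame_smooth : ∀ a i, ContMDiffOn (𝓡 n) ((𝓡 n).prod 𝓘(ℝ, EuclideanSpace ℝ (Fin n))) ∞
    (fun x ↦ (⟨x, frame a i x⟩ : TangentBundle (𝓡 n) N)) (dom a)
  frame_orthonormal : ∀ a, ∀ x ∈ dom a, Orthonormal ℝ (fun i ↦ frame a i x)
  lift : ι → ι → N → spinGroup (euclideanForm n)
  /-- smoothness, tested against the linear functionals of the Clifford algebra (which is a
  finite-dimensional real vector space) -/
  lift_smooth : ∀ a b (ℓ : CliffordAlgebra (euclideanForm n) →ₗ[ℝ] ℝ),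
    ContMDiffOn (𝓡 n) 𝓘(ℝ, ℝ) ∞ (fun x ↦ ℓ (lift a b x)) (dom a ∩ dom b)
  lift_covers : ∀ a b, ∀ x ∈ dom a ∩ dom b, ∀ X : TangentSpace (𝓡 n) x,
    (lift a b x : CliffordAlgebra (euclideanForm n)) *
        cliffordVec (frameCoord (fun i ↦ frame b i x) X) *
        ((lift a b x)⁻¹ : spinGroup (euclideanForm n)) =
      cliffordVec (frameCoord (fun i ↦ frame a i x) X)
  lift_mul : ∀ a b c, ∀ x ∈ dom a ∩ dom b ∩ dom c, lift a b x * lift b c x = lift a c x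

namespace SpinStructure

variable {ι : Type*} (σ : SpinStructure n N ι)
  {S : Type*} [NormedAddCommGroup S] [InnerProductSpace ℂ S] [FiniteDimensional ℂ S]
  (P : SpinorModule n S)

theorem lift_self (a : ι) (x : N) (hx : x ∈ σ.dom a) : σ.lift a a x = 1 := by
  have h := σ.lift_mul a a a x ⟨⟨hx, hx⟩, hx⟩
  exact mul_eq_left.mp h

theorem contMDiffOn_rep_lift (a b : ι) :
    ContMDiffOn (𝓡 n) 𝓘(ℝ, S →L[ℝ] S) ∞
      (fun x ↦ endToRealCLM S (P.rep (σ.lift a b x))) (σ.dom a ∩ σ.dom b) := by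
  have : FiniteDimensional ℝ S := FiniteDimensional.complexToReal S
  let B := Module.finBasis ℝ (S →L[ℝ] S)
  have h : ∀ x, endToRealCLM S (P.rep (σ.lift a b x)) =
      ∑ i, (B.coord i (endToRealCLM S (P.rep (σ.lift a b x)))) • B i :=
    fun x ↦ (B.sum_repr _).symm
  rw [funext h]
  refine contMDiffOn_finsetSum fun i _ ↦ ?_
  exact (σ.lift_smooth a b
    (B.coord i ∘ₗ endToRealCLM S ∘ₗ P.rep.toLinearMap)).smul contMDiffOn_const

/-- The spinor bundle `ΣN`, the vector bundle with fibre `Σₙ` associated with the spin structure: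
the coordinates `s_a`, `s_b` of a spinor in the local trivializations `a` and `b` are related by
`s_b = lift b a · s_a`. -/
def spinorBundle : VectorBundleCore ℝ N S ι where
  baseSet := σ.dom
  isOpen_baseSet := σ.isOpen_dom
  indexAt x := (σ.covers x).choose
  mem_baseSet_at x := (σ.covers x).choose_spec
  coordChange a b x := endToRealCLM S (P.rep (σ.lift b a x))
  coordChange_self a x hx v := by simp [σ.lift_self a x hx]
  continuousOn_coordChange a b := by
    rw [Set.inter_comm]
    exact (σ.contMDiffOn_rep_lift P b a).continuousOn
  coordChange_comp a b c x hx v := by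
    have h := σ.lift_mul c b a x ⟨⟨hx.2, hx.1.2⟩, hx.1.1⟩
    rw [endToRealCLM_apply, endToRealCLM_apply, endToRealCLM_apply, ← h]
    simp

instance : (σ.spinorBundle P).IsContMDiff (𝓡 n) ∞ where
  contMDiffOn_coordChange a b := by
    rw [Set.inter_comm]
    exact σ.contMDiffOn_rep_lift P b a

/-- The fibre `Σ_x N`.  As for every bundle given by a cocycle, it is a copy of the model fibre,
by means of the preferred local trivialization `indexAt x` around `x`. -/
abbrev Spinor (x : N) : Type _ := (σ.spinorBundle P).Fiber x

instance (x : N) : Module ℂ (σ.Spinor P x) := inferInstanceAs (Module ℂ S)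

variable {P} in
/-- The coordinates in `S` of a spinor at `x`, in the preferred local trivialization. -/
def coord {x : N} : σ.Spinor P x ≃ₗ[ℂ] S := LinearEquiv.refl ℂ S

/-- The index of the preferred local trivialization around `x`. -/
abbrev index (x : N) : ι := (σ.covers x).choose

variable {P}

/-- The `S`-valued function representing the spinor field `φ` in the local trivialization `a`. -/
def localRep (a : ι) (φ : (x : N) → σ.Spinor P x) (x : N) : S :=
  (σ.spinorBundle P).coordChange (σ.index x) a x (φ x)

/-- The Hermitian product `⟨ψ, φ⟩` on `Σ_x N`, complex linear in the first argument `ψ`.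
(The transition functions act by unitary maps, so any other trivialization gives the same.) -/
def spinorInner {x : N} (ψ φ : σ.Spinor P x) : ℂ := inner ℂ (σ.coord φ) (σ.coord ψ)

/-- The norm `‖φ‖ = √⟨φ, φ⟩` on `Σ_x N`. -/
def spinorNorm {x : N} (φ : σ.Spinor P x) : ℝ := √(σ.spinorInner φ φ).re

/-- Clifford multiplication `X · φ` on `Σ_x N`. -/
def cliffordMul {x : N} (X : TangentSpace (𝓡 n) x) (φ : σ.Spinor P x) : σ.Spinor P x :=
  σ.coord.symm
    (P.rep (cliffordVec (frameCoord (fun i ↦ σ.frame (σ.index x) i x) X)) (σ.coord φ))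

/-- For the frame `(eᵢ)` with index `a`: the number `h(∇_{e_k} e_i, e_j)` for the Levi-Civita
connection `∇`, by the Koszul formula (in which the derivatives of the constant functions
`h(e_i, e_j)` drop out). -/
def christoffel (a : ι) (k i j : Fin n) (x : N) : ℝ :=
  (inner ℝ (VectorField.mlieBracket (𝓡 n) (σ.frame a k) (σ.frame a i) x) (σ.frame a j x)
    - inner ℝ (VectorField.mlieBracket (𝓡 n) (σ.frame a i) (σ.frame a j) x) (σ.frame a k x)
    + inner ℝ (VectorField.mlieBracket (𝓡 n) (σ.frame a j) (σ.frame a k) x) (σ.frame a i x)) / 2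

/-- The Levi-Civita connection form `h(∇_X e_i, e_j)` of the frame `a`. -/
def connForm (a : ι) (i j : Fin n) (x : N) (X : TangentSpace (𝓡 n) x) : ℝ :=
  ∑ k, inner ℝ (σ.frame a k x) X * σ.christoffel a k i j x

/-- The covariant derivative `∇_X φ` of a spinor field, for the connection on `ΣN` induced by the
Levi-Civita connection: in the local trivialization `a` around `x`,
`∇_X φ = X(φ_a) + ¼ ∑_{i,j} h(∇_X e_i, e_j) e_i · e_j · φ_a`. -/
def spinorCovDeriv (φ : (x : N) → σ.Spinor P x) (x : N) (X : TangentSpace (𝓡 n) x) :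
    σ.Spinor P x :=
  σ.coord.symm
    (mvfderiv (𝓡 n) (σ.localRep (σ.index x) φ) x X +
      (1 / 4 : ℝ) • ∑ i, ∑ j, σ.connForm (σ.index x) i j x X •
        P.rep (cliffordVec (EuclideanSpace.single i 1) * cliffordVec (EuclideanSpace.single j 1))
          (σ.coord (φ x)))

/-- The Dirac current `U_φ`, written in the orthonormal frame `(e_i)`:
`U_φ = ∑ᵢ (-i ⟨e_i · φ, φ⟩) e_i`.  See `inner_diracCurrent` for its defining property. -/
def diracCurrent (φ : (x : N) → σ.Spinor P x) (x : N) : TangentSpace (𝓡 n) x :=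
  ∑ i, (-Complex.I * σ.spinorInner (σ.cliffordMul (σ.frame (σ.index x) i x) (φ x)) (φ x)).re •
    σ.frame (σ.index x) i x

/-- Smooth spinor fields, `φ ∈ Γ(ΣN)`. -/
def IsSmoothSpinor (φ : (x : N) → σ.Spinor P x) : Prop :=
  ContMDiff (𝓡 n) ((𝓡 n).prod 𝓘(ℝ, S)) ∞ fun x ↦ TotalSpace.mk' S x (φ x)

end SpinStructure

/-! ### Gradient and adjoint on a Riemannian manifold -/

instance tangentSpace_finiteDimensional (x : N) : FiniteDimensional ℝ (TangentSpace (𝓡 n) x) :=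
  inferInstanceAs (FiniteDimensional ℝ (EuclideanSpace ℝ (Fin n)))

instance tangentSpace_completeSpace (x : N) : CompleteSpace (TangentSpace (𝓡 n) x) :=
  FiniteDimensional.complete ℝ _

/-- The gradient of `f` at `x`: the vector with `h(grad f, X) = df(X)` for all `X`. -/
def riemannianGrad (f : N → ℝ) (x : N) : TangentSpace (𝓡 n) x :=
  (InnerProductSpace.toDual ℝ (TangentSpace (𝓡 n) x)).symm (mvfderiv (𝓡 n) f x)

/-! ### Consistency of the definitions -/

namespace SpinStructure

variable {ι : Type*} (σ : SpinStructure n N ι)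
  {S : Type*} [NormedAddCommGroup S] [InnerProductSpace ℂ S] [FiniteDimensional ℂ S]
  {P : SpinorModule n S}

/-- The adjoint of the action of an element of the Clifford algebra. -/
theorem _root_.SpinorModule.inner_rep (c : CliffordAlgebra (euclideanForm n)) (s t : S) :
    inner ℂ (P.rep c s) t = inner ℂ s (P.rep (star c) t) := by
  induction c using CliffordAlgebra.induction generalizing s t with
  | algebraMap r =>
    rw [CliffordAlgebra.star_algebraMap, AlgHom.commutes, Module.algebraMap_end_apply,
      Module.algebraMap_end_apply, ← Complex.coe_smul, ← Complex.coe_smul, inner_smul_left,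
      inner_smul_right, Complex.conj_ofReal]
  | ι v => rw [CliffordAlgebra.star_ι, map_neg, LinearMap.neg_apply, inner_neg_right, P.skew]
  | mul a b ha hb => simp [ha, hb]
  | add a b ha hb => rw [star_add, map_add, map_add, LinearMap.add_apply, LinearMap.add_apply, inner_add_left,
      inner_add_right, ha, hb]

/-- The Hermitian product may be computed in any local trivialization. -/
theorem spinorInner_eq (ψ φ : (x : N) → σ.Spinor P x) (a : ι) (x : N) :
    σ.spinorInner (ψ x) (φ x) = inner ℂ (σ.localRep a φ x) (σ.localRep a ψ x) := by
  have h : star (σ.lift a (σ.index x) x : CliffordAlgebra (euclideanForm n)) *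
      σ.lift a (σ.index x) x = 1 := spinGroup.star_mul_self_of_mem (σ.lift a (σ.index x) x).2
  change _ = inner ℂ (P.rep (σ.lift a (σ.index x) x) (σ.coord (φ x)))
    (P.rep (σ.lift a (σ.index x) x) (σ.coord (ψ x)))
  rw [SpinorModule.inner_rep, ← Module.End.mul_apply, ← map_mul, h, map_one]
  rfl

/-- Clifford multiplication may be computed in any local trivialization. -/
theorem localRep_cliffordMul (X : (x : N) → TangentSpace (𝓡 n) x) (φ : (x : N) → σ.Spinor P x)
    (a : ι) (x : N) (hx : x ∈ σ.dom a) :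
    σ.localRep a (fun y ↦ σ.cliffordMul (X y) (φ y)) x =
      P.rep (cliffordVec (frameCoord (fun i ↦ σ.frame a i x) (X x))) (σ.localRep a φ x) := by
  have h : star (σ.lift a (σ.index x) x : CliffordAlgebra (euclideanForm n)) *
      σ.lift a (σ.index x) x = 1 := spinGroup.star_mul_self_of_mem (σ.lift a (σ.index x) x).2
  have h2 := σ.lift_covers a (σ.index x) x ⟨hx, (σ.covers x).choose_spec⟩ (X x)
  change _ * _ * star (σ.lift a (σ.index x) x : CliffordAlgebra (euclideanForm n)) = _ at h2
  change P.rep (σ.lift a (σ.index x) x) (P.rep (cliffordVec _) (σ.coord (φ x))) =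
    P.rep _ (P.rep (σ.lift a (σ.index x) x) (σ.coord (φ x)))
  rw [← Module.End.mul_apply, ← map_mul, ← Module.End.mul_apply, ← map_mul, ← h2,
    mul_assoc _ (star _), h, mul_one]

/-- The defining property of the Dirac current: `h(U_φ, X) = -i ⟨X · φ, φ⟩`. -/
theorem inner_diracCurrent (φ : (x : N) → σ.Spinor P x) (x : N) (X : TangentSpace (𝓡 n) x) :
    ((inner ℝ (σ.diracCurrent φ x) X : ℝ) : ℂ) =
      -Complex.I * σ.spinorInner (σ.cliffordMul X (φ x)) (φ x) := by
  have ho := σ.frame_orthonormal _ x (σ.covers x).choose_spec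
  have hv : ∀ v : EuclideanSpace ℝ (Fin n),
      (((-Complex.I * inner ℂ (σ.coord (φ x)) (P.rep (cliffordVec v) (σ.coord (φ x)))).re : ℝ) :
        ℂ) = -Complex.I * inner ℂ (σ.coord (φ x)) (P.rep (cliffordVec v) (σ.coord (φ x))) := by
    intro v
    have h1 := P.skew v (σ.coord (φ x)) (σ.coord (φ x))
    rw [← inner_conj_symm] at h1
    have h2 := congrArg Complex.re h1
    simp only [Complex.conj_re, Complex.neg_re] at h2
    apply Complex.ext <;> simp
    linarith
  have hX : σ.spinorInner (σ.cliffordMul X (φ x)) (φ x) =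
      ∑ i, ((inner ℝ (σ.frame (σ.index x) i x) X : ℝ) : ℂ) *
        inner ℂ (σ.coord (φ x))
          (P.rep (cliffordVec (EuclideanSpace.single i 1)) (σ.coord (φ x))) := by
    have hc : frameCoord (fun i ↦ σ.frame (σ.index x) i x) X =
        ∑ i, (inner ℝ (σ.frame (σ.index x) i x) X : ℝ) • EuclideanSpace.single i (1 : ℝ) := by
      ext j
      simp [frameCoord, Finset.sum_apply, Pi.single_apply]
    simp only [spinorInner, cliffordMul, LinearEquiv.apply_symm_apply, cliffordVec, hc, map_sum,
      map_smul, LinearMap.sum_apply, inner_sum]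
    refine Finset.sum_congr rfl fun i _ ↦ ?_
    rw [LinearMap.smul_apply, ← Complex.coe_smul, inner_smul_right]
  have he : ∀ i, frameCoord (fun i ↦ σ.frame (σ.index x) i x) (σ.frame (σ.index x) i x) =
      EuclideanSpace.single i 1 := by
    intro i
    ext j
    simp [frameCoord, orthonormal_iff_ite.mp ho]
  rw [hX, Finset.mul_sum, diracCurrent, sum_inner, Complex.ofReal_sum]
  refine Finset.sum_congr rfl fun i _ ↦ ?_
  rw [real_inner_smul_left, Complex.ofReal_mul]
  simp only [spinorInner, cliffordMul, LinearEquiv.apply_symm_apply, he, hv]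
  ring

/-- The functions `christoffel` are the numbers `h(∇_{e_k} e_i, e_j)` for every torsion-free metric
connection `∇` on the tangent bundle. -/
theorem christoffel_eq [IsContMDiffRiemannianBundle (𝓡 n) 1 (EuclideanSpace ℝ (Fin n))
      (fun x : N ↦ TangentSpace (𝓡 n) x)]
    (D : CovariantDerivative (𝓡 n) (EuclideanSpace ℝ (Fin n))
      (fun x : N ↦ TangentSpace (𝓡 n) x))
    (hmetric : D.IsMetricCompatible) (htorsion : D.torsion = 0)
    (a : ι) (k i j : Fin n) (x : N) (hx : x ∈ σ.dom a) :
    σ.christoffel a k i j x =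
      inner ℝ (D (σ.frame a i) x (σ.frame a k x)) (σ.frame a j x) := by
  have hd : ∀ i, MDifferentiableAt (𝓡 n) ((𝓡 n).prod 𝓘(ℝ, EuclideanSpace ℝ (Fin n)))
      (fun x ↦ (⟨x, σ.frame a i x⟩ : TangentBundle (𝓡 n) N)) x := fun i ↦
    ((σ.frame_smooth a i).contMDiffAt ((σ.isOpen_dom a).mem_nhds hx)).mdifferentiableAt
      (by simp)
  have ht : ∀ i j, D (σ.frame a j) x (σ.frame a i x) - D (σ.frame a i) x (σ.frame a j x) =
      VectorField.mlieBracket (𝓡 n) (σ.frame a i) (σ.frame a j) x := fun i j ↦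
    D.torsion_eq_zero_iff.mp htorsion (hd i) (hd j)
  have hm : ∀ i j k, inner ℝ (D (σ.frame a i) x (σ.frame a k x)) (σ.frame a j x) +
      inner ℝ (D (σ.frame a j) x (σ.frame a k x)) (σ.frame a i x) = 0 := by
    intro i j k
    have h := hmetric.mvfderiv_inner_eq (σ.frame a k) (hd i) (hd j)
    have hc : (fun y ↦ inner ℝ (σ.frame a i y) (σ.frame a j y)) =ᶠ[nhds x]
        fun _ ↦ (if i = j then (1 : ℝ) else 0) := by
      filter_upwards [(σ.isOpen_dom a).mem_nhds hx] with y hy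
      exact orthonormal_iff_ite.mp (σ.frame_orthonormal a y hy) i j
    rw [mvfderiv, hc.mfderiv_eq, mfderiv_const] at h
    rw [real_inner_comm (σ.frame a i x), ← h]
    rfl
  unfold christoffel
  rw [← ht k i, ← ht i j, ← ht j k]
  simp only [inner_sub_left]
  linarith [hm i j k, hm j k i, hm k i j]

end SpinStructure

/-- The defining property of the gradient: `h(grad f, X) = df(X)`. -/
theorem inner_riemannianGrad (f : N → ℝ) (x : N) (X : TangentSpace (𝓡 n) x) :
    inner ℝ (riemannianGrad f x) X = mvfderiv (𝓡 n) f x X :=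
  InnerProductSpace.toDual_symm_apply

end Spin

end

/-! Write f = ⟨φ,φ⟩ and U = U_φ. The spinor connection is metric, so df(X) = 2 Re⟨∇_X φ, φ⟩, and the
equation for ∇φ turns this into -h(U, W X). This is the gradient formula
(`mvfderiv_spinorInner_self_eq`), and it makes f locally constant when U ≡ 0.

The rest is algebra at a point plus connectedness. Pairing U·φ = iuφ with φ gives |U|² = u f
(`norm_diracCurrent_sq`). Multiplying it by U once more gives |U|² = u² where φ ≠ 0
(`norm_diracCurrent_eq_abs`). Hence u is 0 or f there, and |U| ≤ f everywhere
(`norm_diracCurrent_le`).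

Since W is locally bounded, |df(X)| ≤ K |X| f locally, and Grönwall makes the closed set {f = 0}
open. If U is nonzero somewhere, f is nonzero there, hence everywhere by connectedness. Then {u = f}
is the complement of {u = 0}, so it is clopen and, being nonempty, all of N; thus u = f = |U|. -/

section

open Filter Topology

/-! ### Grönwall's inequality, from segments to charts -/

section Gronwall

/-- A differentiable function on a ball whose derivative is
bounded by a multiple of the function vanishes if it vanishes at the centre. -/
theorem eqOn_zero_ball_of_norm_fderiv_le {E : Type*} [NormedAddCommGroup E] [NormedSpace ℝ E]
    {g : E → ℝ} {g' : E → E →L[ℝ] ℝ} {c : E} {r K : ℝ}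
    (hg : ∀ z ∈ Metric.ball c r, HasFDerivAt g (g' z) z)
    (bound : ∀ z ∈ Metric.ball c r, ∀ v, |g' z v| ≤ K * ‖v‖ * |g z|) (h0 : g c = 0) :
    ∀ z ∈ Metric.ball c r, g z = 0 := by
  intro z hz
  -- Restriction to the segment from c to z reduces the claim to the one-variable Grönwall lemma,
  -- with constant K‖z - c‖.
  have hmem : ∀ t ∈ Set.Icc (0 : ℝ) 1, c + t • (z - c) ∈ Metric.ball c r := by
    intro t ht
    have hr := Metric.mem_ball.mp hz
    rw [dist_eq_norm] at hr
    rw [Metric.mem_ball, dist_eq_norm, add_sub_cancel_left, norm_smul, Real.norm_of_nonneg ht.1]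
    nlinarith [ht.1, ht.2, norm_nonneg (z - c)]
  have hd : ∀ t ∈ Set.Icc (0 : ℝ) 1,
      HasDerivAt (fun t : ℝ ↦ g (c + t • (z - c))) (g' (c + t • (z - c)) (z - c)) t := by
    intro t ht
    have hl : HasDerivAt (fun t : ℝ ↦ c + t • (z - c)) (z - c) t := by
      simpa using ((hasDerivAt_id t).smul_const (z - c)).const_add c
    exact (hg _ (hmem t ht)).comp_hasDerivAt t hl
  have key := eq_zero_of_abs_deriv_le_mul_abs_self_of_eq_zero_right (K := K * ‖z - c‖)
    (fun t ht ↦ (hd t ht).continuousAt.continuousWithinAt)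
    (fun t ht ↦ (hd t (Set.Ico_subset_Icc_self ht)).hasDerivWithinAt)
    (by simpa using h0)
    (fun t ht ↦ bound _ (hmem t (Set.Ico_subset_Icc_self ht)) (z - c)) 1 (by simp)
  simpa using key

variable {n : ℕ} {N : Type*} [TopologicalSpace N] [ChartedSpace (EuclideanSpace ℝ (Fin n)) N]
  [IsManifold (𝓡 n) ∞ N]

/-- The derivative of a function read in a chart, in terms of the trivialization of the tangent
bundle defined by this chart. -/
theorem hasFDerivAt_comp_extChartAt_symm {f : N → ℝ}
    (hf : MDifferentiable (𝓡 n) 𝓘(ℝ, ℝ) f) {x₀ x : N}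
    (hx : x ∈ (chartAt (EuclideanSpace ℝ (Fin n)) x₀).source) :
    HasFDerivAt (f ∘ (extChartAt (𝓡 n) x₀).symm)
      ((mvfderiv (𝓡 n) f x).comp
        ((trivializationAt (EuclideanSpace ℝ (Fin n)) (TangentSpace (𝓡 n)) x₀).symmL ℝ x))
      (extChartAt (𝓡 n) x₀ x) := by
  have hx' : x ∈ (extChartAt (𝓡 n) x₀).source := by simpa using hx
  have hleft := (extChartAt (𝓡 n) x₀).left_inv hx'
  have h1 := (mdifferentiableWithinAt_extChartAt_symm (I := 𝓡 n)
    ((extChartAt (𝓡 n) x₀).map_source hx')).hasMFDerivWithinAt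
  have h2 : HasMFDerivAt (𝓡 n) 𝓘(ℝ, ℝ) f ((extChartAt (𝓡 n) x₀).symm (extChartAt (𝓡 n) x₀ x))
      (mfderiv (𝓡 n) 𝓘(ℝ, ℝ) f x) := by
    rw [hleft]
    exact (hf x).hasMFDerivAt
  have h3 := (h2.comp_hasMFDerivWithinAt _ h1).hasFDerivWithinAt
  -- The inverse trivialization at x is the derivative of the inverse chart, so the chain rule gives
  -- exactly the stated composition.
  rw [TangentBundle.symmL_trivializationAt (𝕜 := ℝ) hx]
  rw [ModelWithCorners.Boundaryless.range_eq_univ] at h3 ⊢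
  exact hasFDerivWithinAt_univ.mp h3

variable [RiemannianBundle (fun x : N ↦ TangentSpace (𝓡 n) x)]
  [IsContMDiffRiemannianBundle (𝓡 n) ∞ (EuclideanSpace ℝ (Fin n))
    (fun x : N ↦ TangentSpace (𝓡 n) x)]

/-- Grönwall's inequality on a Riemannian manifold: if `|df| ≤ K |f|` near a zero of `f`, then `f`
vanishes near this zero. -/
theorem eventually_eq_zero_of_abs_mvfderiv_le {f : N → ℝ}
    (hf : MDifferentiable (𝓡 n) 𝓘(ℝ, ℝ) f) {x₀ : N} {K : ℝ} (hK0 : 0 ≤ K)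
    (hK : ∀ᶠ x in 𝓝 x₀, ∀ X : TangentSpace (𝓡 n) x, |mvfderiv (𝓡 n) f x X| ≤ K * ‖X‖ * |f x|)
    (h0 : f x₀ = 0) : ∀ᶠ x in 𝓝 x₀, f x = 0 := by
  have : IsContinuousRiemannianBundle (EuclideanSpace ℝ (Fin n))
      (fun x : N ↦ TangentSpace (𝓡 n) x) := by
    obtain ⟨g, hg, h⟩ := IsContMDiffRiemannianBundle.exists_contMDiff (IB := 𝓡 n) (n := ∞)
      (F := EuclideanSpace ℝ (Fin n)) (E := fun x : N ↦ TangentSpace (𝓡 n) x)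
    exact ⟨g, hg.continuous, h⟩
  -- C compares the Riemannian norm with the coordinate norm near x₀; the Grönwall constant in the
  -- chart is therefore K * C.
  obtain ⟨C, hC0, hC⟩ := eventually_norm_symmL_trivializationAt_lt (EuclideanSpace ℝ (Fin n))
    (fun x : N ↦ TangentSpace (𝓡 n) x) x₀
  have hsrc := chart_source_mem_nhds (EuclideanSpace ℝ (Fin n)) x₀
  have hcont : Tendsto (extChartAt (𝓡 n) x₀).symm (𝓝 (extChartAt (𝓡 n) x₀ x₀)) (𝓝 x₀) := by
    simpa only [ContinuousAt, extChartAt_to_inv] using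
      continuousAt_extChartAt_symm (I := 𝓡 n) x₀
  obtain ⟨r, hr, hball⟩ := Metric.eventually_nhds_iff_ball.mp
    ((hcont.eventually (hK.and (hC.and hsrc))).and (extChartAt_target_mem_nhds (I := 𝓡 n) x₀))
  have hd : ∀ z ∈ Metric.ball (extChartAt (𝓡 n) x₀ x₀) r, HasFDerivAt
      (f ∘ (extChartAt (𝓡 n) x₀).symm)
      ((mvfderiv (𝓡 n) f ((extChartAt (𝓡 n) x₀).symm z)).comp
        ((trivializationAt (EuclideanSpace ℝ (Fin n)) (TangentSpace (𝓡 n)) x₀).symmL ℝ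
          ((extChartAt (𝓡 n) x₀).symm z))) z := by
    intro z hz
    have h := hasFDerivAt_comp_extChartAt_symm hf (hball z hz).1.2.2
    rwa [(extChartAt (𝓡 n) x₀).right_inv (hball z hz).2] at h
  have hzero := eqOn_zero_ball_of_norm_fderiv_le (K := K * C) hd (fun z hz v ↦ by
    refine ((hball z hz).1.1 _).trans ?_
    refine mul_le_mul_of_nonneg_right ?_ (abs_nonneg _)
    rw [mul_assoc K C]
    gcongr
    exact (ContinuousLinearMap.le_opNorm _ _).trans (by gcongr; exact (hball z hz).1.2.1.le))
    (by simpa using h0)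
  filter_upwards [hsrc, (continuousAt_extChartAt (I := 𝓡 n) x₀).preimage_mem_nhds
    (Metric.ball_mem_nhds _ hr)] with x hx hxb
  have h := hzero _ hxb
  rwa [Function.comp_apply, (extChartAt (𝓡 n) x₀).left_inv (by simpa using hx)] at h

end Gronwall

/-! ### Clopen zero sets, orthonormal frames, Clifford algebra -/

theorem isClopen_setOf_eq_zero_of_eventually {N : Type*} [TopologicalSpace N] {f : N → ℝ}
    (hf : Continuous f) (h : ∀ x, f x = 0 → ∀ᶠ y in 𝓝 x, f y = 0) : IsClopen {x | f x = 0} :=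
  ⟨isClosed_eq hf continuous_const, isOpen_iff_mem_nhds.mpr h⟩

theorem top_le_span_range_of_orthonormal {n : ℕ} {N : Type*} [TopologicalSpace N]
    [ChartedSpace (EuclideanSpace ℝ (Fin n)) N]
    [RiemannianBundle (fun x : N ↦ TangentSpace (𝓡 n) x)] {x : N}
    {e : Fin n → TangentSpace (𝓡 n) x} (he : Orthonormal ℝ e) :
    ⊤ ≤ Submodule.span ℝ (Set.range e) := by
  have hcard : Fintype.card (Fin n) = Module.finrank ℝ (TangentSpace (𝓡 n) x) := by
    -- As a vector space the tangent space is the model space; only the norm differs.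
    change _ = Module.finrank ℝ (EuclideanSpace ℝ (Fin n))
    simp
  exact (he.linearIndependent.span_eq_top_of_card_eq_finrank' hcard).ge

/-- Such a c acts by a skew-Hermitian map, whose quadratic form is purely imaginary. -/
theorem SpinorModule.re_inner_rep_eq_zero {n : ℕ} {S : Type*} [NormedAddCommGroup S]
    [InnerProductSpace ℂ S] [FiniteDimensional ℂ S] (P : SpinorModule n S)
    {c : CliffordAlgebra (euclideanForm n)} (hc : star c = -c) (s : S) :
    (inner ℂ s (P.rep c s)).re = 0 := by
  have h := SpinorModule.inner_rep (P := P) c s s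
  rw [hc, map_neg, LinearMap.neg_apply, inner_neg_right, ← inner_conj_symm] at h
  have h2 := congrArg Complex.re h
  simp only [Complex.conj_re, Complex.neg_re] at h2
  linarith

theorem SpinorModule.rep_cliffordVec_rep_cliffordVec {n : ℕ} {S : Type*} [NormedAddCommGroup S]
    [InnerProductSpace ℂ S] [FiniteDimensional ℂ S] (P : SpinorModule n S)
    (v : EuclideanSpace ℝ (Fin n)) (s : S) :
    P.rep (cliffordVec v) (P.rep (cliffordVec v) s) = ((-‖v‖ ^ 2 : ℝ) : ℂ) • s := by
  rw [← Module.End.mul_apply, ← map_mul, CliffordAlgebra.ι_sq_scalar, euclideanForm_apply,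
    AlgHom.commutes, Module.algebraMap_end_apply, Complex.coe_smul]

/-- `star` reverses the product and the two signs cancel; orthogonal vectors anticommute. This makes
the connection terms e_i · e_j skew. -/
theorem star_cliffordVec_single_mul {n : ℕ} {i j : Fin n} (hij : i ≠ j) :
    star (cliffordVec (EuclideanSpace.single i (1 : ℝ)) *
        cliffordVec (EuclideanSpace.single j (1 : ℝ))) =
      -(cliffordVec (EuclideanSpace.single i (1 : ℝ)) *
        cliffordVec (EuclideanSpace.single j (1 : ℝ))) := by
  rw [star_mul, CliffordAlgebra.star_ι, CliffordAlgebra.star_ι, neg_mul_neg,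
    eq_neg_iff_add_eq_zero, CliffordAlgebra.ι_mul_ι_add_swap]
  have h : QuadraticMap.polar (euclideanForm n) (EuclideanSpace.single j 1)
      (EuclideanSpace.single i 1) = 0 := by
    rw [QuadraticMap.polar, euclideanForm_apply, euclideanForm_apply, euclideanForm_apply,
      norm_add_sq_real]
    simp [EuclideanSpace.inner_single_left, hij]
  rw [h, map_zero]

namespace SpinStructure

variable {n : ℕ} {N : Type*} [TopologicalSpace N] [ChartedSpace (EuclideanSpace ℝ (Fin n)) N]
  [IsManifold (𝓡 n) ∞ N] [RiemannianBundle (fun x : N ↦ TangentSpace (𝓡 n) x)]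
  {ι : Type*} (σ : SpinStructure n N ι)
  {S : Type*} [NormedAddCommGroup S] [InnerProductSpace ℂ S] [FiniteDimensional ℂ S]
  {P : SpinorModule n S}

/-! ### Local boundedness of endomorphism fields -/

/-- A smooth field of endomorphisms of the tangent bundle is locally bounded. -/
theorem eventually_norm_apply_le (σ : SpinStructure n N ι)
    [IsContMDiffRiemannianBundle (𝓡 n) ∞ (EuclideanSpace ℝ (Fin n))
      (fun x : N ↦ TangentSpace (𝓡 n) x)]
    {W : (x : N) → TangentSpace (𝓡 n) x →L[ℝ] TangentSpace (𝓡 n) x}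
    (hW : ContMDiff (𝓡 n)
      ((𝓡 n).prod 𝓘(ℝ, EuclideanSpace ℝ (Fin n) →L[ℝ] EuclideanSpace ℝ (Fin n))) ∞
      fun x ↦ TotalSpace.mk' (EuclideanSpace ℝ (Fin n) →L[ℝ] EuclideanSpace ℝ (Fin n))
        (E := fun x : N ↦ TangentSpace (𝓡 n) x →L[ℝ] TangentSpace (𝓡 n) x) x (W x)) (x₀ : N) :
    ∃ K : ℝ, 0 ≤ K ∧ ∀ᶠ x in 𝓝 x₀, ∀ X : TangentSpace (𝓡 n) x, ‖W x X‖ ≤ K * ‖X‖ := by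
  obtain ⟨a, ha⟩ := σ.covers x₀
  have hdom := (σ.isOpen_dom a).mem_nhds ha
  have hWe : ∀ i, ContMDiffOn (𝓡 n) ((𝓡 n).prod 𝓘(ℝ, EuclideanSpace ℝ (Fin n))) ∞
      (fun x ↦ (⟨x, W x (σ.frame a i x)⟩ : TangentBundle (𝓡 n) N)) (σ.dom a) :=
    fun i ↦ hW.contMDiffOn.clm_bundle_apply (σ.frame_smooth a i)
  have hb : ∀ i, ∃ C : ℝ, 0 ≤ C ∧ ∀ᶠ x in 𝓝 x₀, ‖W x (σ.frame a i x)‖ ≤ C := by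
    intro i
    -- By continuity |W e_i|² stays below its value at x₀ plus 1.
    have hc := (((hWe i).inner_bundle (hWe i)).continuousOn.continuousAt hdom)
    refine ⟨√(inner ℝ (W x₀ (σ.frame a i x₀)) (W x₀ (σ.frame a i x₀)) + 1), Real.sqrt_nonneg _, ?_⟩
    filter_upwards [hc.eventually (eventually_lt_nhds (lt_add_one _))] with x hx
    rw [norm_eq_sqrt_real_inner]
    exact Real.sqrt_le_sqrt hx.le
  choose C hC0 hC using hb
  refine ⟨∑ i, C i, Finset.sum_nonneg fun i _ ↦ hC0 i, ?_⟩
  filter_upwards [eventually_all.mpr hC, hdom] with x hx hxa X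
  have ho := σ.frame_orthonormal a x hxa
  let b := OrthonormalBasis.mk ho (top_le_span_range_of_orthonormal ho)
  have hX : X = ∑ i, (inner ℝ (σ.frame a i x) X : ℝ) • σ.frame a i x := by
    simpa [b] using (b.sum_repr' X).symm
  calc ‖W x X‖ = ‖∑ i, (inner ℝ (σ.frame a i x) X : ℝ) • W x (σ.frame a i x)‖ := by
        conv_lhs => rw [hX]
        simp only [map_sum, map_smul]
    _ ≤ ∑ i, ‖X‖ * C i := by
        refine (norm_sum_le _ _).trans (Finset.sum_le_sum fun i _ ↦ ?_)
        rw [norm_smul]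
        gcongr
        · refine (norm_inner_le_norm _ _).trans ?_
          rw [ho.1 i, one_mul]
        · exact hx i
    _ = (∑ i, C i) * ‖X‖ := by rw [← Finset.mul_sum, mul_comm]

/-! ### Smoothness and the derivative of `⟨φ, φ⟩` -/

theorem contMDiffAt_localRep {φ : (x : N) → σ.Spinor P x} (hφ : σ.IsSmoothSpinor φ) (x : N) :
    ContMDiffAt (𝓡 n) 𝓘(ℝ, S) ∞ (σ.localRep (σ.index x) φ) x :=
  (contMDiffAt_section x).mp (hφ x)

/-- The preferred trivialization jumps from point to point, so the product is first rewritten in the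
one fixed at x, where it is the squared norm of a smooth S-valued function. -/
theorem contMDiff_spinorInner_self {φ : (x : N) → σ.Spinor P x} (hφ : σ.IsSmoothSpinor φ) :
    ContMDiff (𝓡 n) 𝓘(ℝ, ℝ) ∞ (fun x ↦ (σ.spinorInner (φ x) (φ x)).re) := by
  intro x
  have h := σ.contMDiffAt_localRep hφ x
  simp only [σ.spinorInner_eq φ φ (σ.index x), ← RCLike.re_eq_complex_re,
    inner_self_eq_norm_sq]
  let _ := InnerProductSpace.rclikeToReal ℂ S
  exact (contDiff_norm_sq ℝ).contMDiff.contMDiffAt.comp x h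

theorem localRep_index (φ : (x : N) → σ.Spinor P x) (x : N) :
    σ.localRep (σ.index x) φ x = σ.coord (φ x) :=
  (σ.spinorBundle P).coordChange_self _ _ ((σ.spinorBundle P).mem_baseSet_at x) _

theorem mvfderiv_spinorInner_self {φ : (x : N) → σ.Spinor P x} (hφ : σ.IsSmoothSpinor φ) (x : N)
    (X : TangentSpace (𝓡 n) x) :
    mvfderiv (𝓡 n) (fun x ↦ (σ.spinorInner (φ x) (φ x)).re) x X =
      2 * (inner ℂ (σ.coord (φ x)) (mvfderiv (𝓡 n) (σ.localRep (σ.index x) φ) x X)).re := by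
  have h := ((σ.contMDiffAt_localRep hφ x).mdifferentiableAt (by simp)).hasMFDerivAt
  let _ := InnerProductSpace.rclikeToReal ℂ S
  have h2 :=
    (hasStrictFDerivAt_norm_sq (σ.localRep (σ.index x) φ x)).hasFDerivAt.hasMFDerivAt.comp x h
  have h3 : (fun x ↦ (σ.spinorInner (φ x) (φ x)).re) =
      (fun s ↦ ‖s‖ ^ 2) ∘ σ.localRep (σ.index x) φ := by
    ext y
    simp only [σ.spinorInner_eq φ φ (σ.index x), ← RCLike.re_eq_complex_re,
      inner_self_eq_norm_sq, Function.comp_apply]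
  rw [mvfderiv, h3, h2.mfderiv, ← localRep_index]
  exact two_nsmul (M := ℝ) _ |>.trans (two_mul _).symm

/-- Antisymmetry of the bracket cancels the Koszul terms. This disposes of the diagonal terms e_i ·
e_i = -1, which are not skew. -/
theorem connForm_self (a : ι) (i : Fin n) (x : N) (X : TangentSpace (𝓡 n) x) :
    σ.connForm a i i x X = 0 := by
  refine Finset.sum_eq_zero fun k _ ↦ ?_
  rw [christoffel, VectorField.mlieBracket_swap_apply (V := σ.frame a i) (W := σ.frame a k)]
  simp

/-- The connection of the spinor bundle is metric. -/
theorem re_inner_spinorCovDeriv (φ : (x : N) → σ.Spinor P x) (x : N) (X : TangentSpace (𝓡 n) x) :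
    (inner ℂ (σ.coord (φ x)) (σ.coord (σ.spinorCovDeriv φ x X))).re =
      (inner ℂ (σ.coord (φ x)) (mvfderiv (𝓡 n) (σ.localRep (σ.index x) φ) x X)).re := by
  rw [spinorCovDeriv, LinearEquiv.apply_symm_apply, inner_add_right, Complex.add_re,
    add_eq_left, ← Complex.coe_smul, inner_smul_right, Complex.re_ofReal_mul, inner_sum,
    Complex.re_sum, Finset.sum_eq_zero, mul_zero]
  intro i _
  rw [inner_sum, Complex.re_sum]
  refine Finset.sum_eq_zero fun j _ ↦ ?_
  rw [← Complex.coe_smul, inner_smul_right, Complex.re_ofReal_mul]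
  rcases eq_or_ne i j with rfl | hij
  · rw [connForm_self, zero_mul]
  · rw [P.re_inner_rep_eq_zero (star_cliffordVec_single_mul hij), mul_zero]

theorem spinorInner_smul_left (c : ℂ) {x : N} (ψ φ : σ.Spinor P x) :
    σ.spinorInner (c • ψ) φ = c * σ.spinorInner ψ φ := by
  rw [spinorInner, map_smul, inner_smul_right, spinorInner]

/-- Since ⟨Y · φ, φ⟩ = i h(U, Y), the factors 2, i/2 and i multiply to -1. -/
theorem mvfderiv_spinorInner_self_eq {φ : (x : N) → σ.Spinor P x} (hφ : σ.IsSmoothSpinor φ)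
    {W : (x : N) → TangentSpace (𝓡 n) x →L[ℝ] TangentSpace (𝓡 n) x}
    (hKilling : ∀ (x : N) (X : TangentSpace (𝓡 n) x),
      σ.spinorCovDeriv φ x X = (Complex.I / 2) • σ.cliffordMul (W x X) (φ x))
    (x : N) (X : TangentSpace (𝓡 n) x) :
    mvfderiv (𝓡 n) (fun x ↦ (σ.spinorInner (φ x) (φ x)).re) x X =
      -inner ℝ (σ.diracCurrent φ x) (W x X) := by
  have h := congrArg Complex.re (σ.inner_diracCurrent φ x (W x X))
  rw [σ.mvfderiv_spinorInner_self hφ, ← re_inner_spinorCovDeriv, hKilling]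
  change 2 * (σ.spinorInner ((Complex.I / 2) • σ.cliffordMul (W x X) (φ x)) (φ x)).re = _
  rw [spinorInner_smul_left]
  simp at h ⊢
  linarith

/-! ### Pointwise algebra of the Dirac current -/

theorem spinorInner_self (φ : (x : N) → σ.Spinor P x) (x : N) :
    σ.spinorInner (φ x) (φ x) = ((‖σ.coord (φ x)‖ ^ 2 : ℝ) : ℂ) := by
  rw [spinorInner, inner_self_eq_norm_sq_to_K]
  simp

theorem norm_frameCoord {x : N} {e : Fin n → TangentSpace (𝓡 n) x} (he : Orthonormal ℝ e)
    (X : TangentSpace (𝓡 n) x) : ‖frameCoord e X‖ = ‖X‖ := by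
  let b := OrthonormalBasis.mk he (top_le_span_range_of_orthonormal he)
  have h : frameCoord e X = b.repr X := by
    ext i
    simp [frameCoord, b.repr_apply_apply, b]
  rw [h, LinearIsometryEquiv.norm_map]

/-- Take X = U in the defining property of U and substitute U · φ = iuφ. -/
theorem norm_diracCurrent_sq {φ : (x : N) → σ.Spinor P x} {u : N → ℝ} {x : N}
    (hDirac : σ.cliffordMul (σ.diracCurrent φ x) (φ x) = (Complex.I * (u x : ℂ)) • φ x) :
    ‖σ.diracCurrent φ x‖ ^ 2 = u x * (σ.spinorInner (φ x) (φ x)).re := by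
  have h := σ.inner_diracCurrent φ x (σ.diracCurrent φ x)
  rw [hDirac, spinorInner_smul_left, real_inner_self_eq_norm_sq] at h
  rw [spinorInner_self] at h ⊢
  apply Complex.ofReal_injective
  rw [Complex.ofReal_re, h, Complex.ofReal_mul]
  linear_combination
    (-(u x : ℂ) * ((‖σ.coord (φ x)‖ ^ 2 : ℝ) : ℂ)) * Complex.I_mul_I

/-- Acting by U twice gives -|U|² φ by the Clifford relation and (iu)² φ by the eigenvalue equation;
φ ≠ 0 allows comparing the scalars. -/
theorem norm_diracCurrent_eq_abs {φ : (x : N) → σ.Spinor P x} {u : N → ℝ} {x : N}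
    (hDirac : σ.cliffordMul (σ.diracCurrent φ x) (φ x) = (Complex.I * (u x : ℂ)) • φ x)
    (h0 : φ x ≠ 0) : ‖σ.diracCurrent φ x‖ = |u x| := by
  have h1 := P.rep_cliffordVec_rep_cliffordVec
    (frameCoord (fun i ↦ σ.frame (σ.index x) i x) (σ.diracCurrent φ x)) (σ.coord (φ x))
  have h2 : P.rep (cliffordVec (frameCoord (fun i ↦ σ.frame (σ.index x) i x)
      (σ.diracCurrent φ x))) (σ.coord (φ x)) = (Complex.I * (u x : ℂ)) • σ.coord (φ x) := hDirac
  have hs : σ.coord (φ x) ≠ 0 := h0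
  rw [h2, map_smul, h2, smul_smul, norm_frameCoord
    (σ.frame_orthonormal _ x (σ.covers x).choose_spec)] at h1
  have h3 := smul_left_injective ℂ hs h1
  have h4 : ((u x ^ 2 : ℝ) : ℂ) = ((‖σ.diracCurrent φ x‖ ^ 2 : ℝ) : ℂ) := by
    push_cast at h3 ⊢
    linear_combination -h3 + (u x : ℂ) ^ 2 * Complex.I_mul_I
  rw [← abs_norm (σ.diracCurrent φ x), ← sq_eq_sq_iff_abs_eq_abs]
  exact (Complex.ofReal_injective h4).symm

theorem re_spinorInner_self_eq_zero_iff (φ : (x : N) → σ.Spinor P x) (x : N) :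
    (σ.spinorInner (φ x) (φ x)).re = 0 ↔ φ x = 0 := by
  rw [spinorInner_self, Complex.ofReal_re, sq_eq_zero_iff, norm_eq_zero,
    LinearEquiv.map_eq_zero_iff]

theorem re_spinorInner_self_nonneg (φ : (x : N) → σ.Spinor P x) (x : N) :
    0 ≤ (σ.spinorInner (φ x) (φ x)).re := by
  rw [spinorInner_self, Complex.ofReal_re]
  positivity

/-- Where `U_φ · φ = i u φ`, the function `u` is `0` or `⟨φ, φ⟩`, unless `φ = 0`. -/
theorem eq_zero_or_eq_re_spinorInner_self {φ : (x : N) → σ.Spinor P x} {u : N → ℝ} {x : N}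
    (hDirac : σ.cliffordMul (σ.diracCurrent φ x) (φ x) = (Complex.I * (u x : ℂ)) • φ x)
    (h0 : φ x ≠ 0) : u x = 0 ∨ u x = (σ.spinorInner (φ x) (φ x)).re := by
  have h1 := σ.norm_diracCurrent_sq hDirac
  -- The two expressions for |U|² give u · u = u · f.
  rw [σ.norm_diracCurrent_eq_abs hDirac h0, sq_abs, sq] at h1
  exact (mul_eq_mul_left_iff.mp h1).symm

/-- This is what feeds Grönwall, which is applied near zeros of φ; there |U|² = u · 0 forces U = 0.
-/
theorem norm_diracCurrent_le {φ : (x : N) → σ.Spinor P x} {u : N → ℝ} {x : N}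
    (hDirac : σ.cliffordMul (σ.diracCurrent φ x) (φ x) = (Complex.I * (u x : ℂ)) • φ x) :
    ‖σ.diracCurrent φ x‖ ≤ (σ.spinorInner (φ x) (φ x)).re := by
  have hnn := σ.re_spinorInner_self_nonneg φ x
  by_cases h0 : φ x = 0
  · have h1 := σ.norm_diracCurrent_sq hDirac
    rw [(σ.re_spinorInner_self_eq_zero_iff φ x).mpr h0, mul_zero] at h1
    rwa [pow_eq_zero_iff two_ne_zero |>.mp h1]
  · rw [σ.norm_diracCurrent_eq_abs hDirac h0]
    rcases σ.eq_zero_or_eq_re_spinorInner_self hDirac h0 with h | h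
    · rwa [h, abs_zero]
    · rw [h, abs_of_nonneg hnn]

end SpinStructure

end

/-! ### Main theorem -/

theorem propositionA6 {n : ℕ} {N : Type*} [TopologicalSpace N]
    [ChartedSpace (EuclideanSpace ℝ (Fin n)) N] [IsManifold (𝓡 n) ∞ N] [ConnectedSpace N]
    [RiemannianBundle (fun x : N ↦ TangentSpace (𝓡 n) x)]
    [IsContMDiffRiemannianBundle (𝓡 n) ∞ (EuclideanSpace ℝ (Fin n))
      (fun x : N ↦ TangentSpace (𝓡 n) x)]
    {ι : Type*} (σ : SpinStructure n N ι)
    {S : Type*} [NormedAddCommGroup S] [InnerProductSpace ℂ S] [FiniteDimensional ℂ S]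
    (P : SpinorModule n S)
    (φ : (x : N) → σ.Spinor P x) (hφ : σ.IsSmoothSpinor φ)
    (W : (x : N) → TangentSpace (𝓡 n) x →L[ℝ] TangentSpace (𝓡 n) x)
    (hW : ContMDiff (𝓡 n)
      ((𝓡 n).prod 𝓘(ℝ, EuclideanSpace ℝ (Fin n) →L[ℝ] EuclideanSpace ℝ (Fin n))) ∞
      fun x ↦ TotalSpace.mk' (EuclideanSpace ℝ (Fin n) →L[ℝ] EuclideanSpace ℝ (Fin n))
        (E := fun x : N ↦ TangentSpace (𝓡 n) x →L[ℝ] TangentSpace (𝓡 n) x) x (W x))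
    (u : N → ℝ) (hu : ContMDiff (𝓡 n) 𝓘(ℝ, ℝ) ∞ u)
    (hKilling : ∀ (x : N) (X : TangentSpace (𝓡 n) x),
      σ.spinorCovDeriv φ x X = (Complex.I / 2) • σ.cliffordMul (W x X) (φ x))
    (hDirac : ∀ x : N,
      σ.cliffordMul (σ.diracCurrent φ x) (φ x) = (Complex.I * (u x : ℂ)) • φ x) :
    (ContMDiff (𝓡 n) 𝓘(ℝ, ℝ) ∞ (fun x ↦ (σ.spinorInner (φ x) (φ x)).re) ∧
      ∀ x : N, riemannianGrad (fun y ↦ (σ.spinorInner (φ y) (φ y)).re) x =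
        -ContinuousLinearMap.adjoint (W x) (σ.diracCurrent φ x)) ∧
    ((∀ x : N, σ.diracCurrent φ x = 0) → ∃ c : ℝ, ∀ x : N, σ.spinorNorm (φ x) = c) ∧
    ((∃ x : N, σ.diracCurrent φ x ≠ 0) →
      (∀ x : N, σ.diracCurrent φ x ≠ 0) ∧ (∀ x : N, φ x ≠ 0) ∧
      ∀ x : N, u x = ‖σ.diracCurrent φ x‖ ∧
        (‖σ.diracCurrent φ x‖ : ℂ) = σ.spinorInner (φ x) (φ x) ∧
        ‖σ.diracCurrent φ x‖ = σ.spinorNorm (φ x) ^ 2) := by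
  set f : N → ℝ := fun x ↦ (σ.spinorInner (φ x) (φ x)).re with hf
  have hsmooth : ContMDiff (𝓡 n) 𝓘(ℝ, ℝ) ∞ f := σ.contMDiff_spinorInner_self hφ
  have hdiff : MDifferentiable (𝓡 n) 𝓘(ℝ, ℝ) f := hsmooth.mdifferentiable (by simp)
  have hderiv : ∀ (x : N) (X : TangentSpace (𝓡 n) x), mvfderiv (𝓡 n) f x X =
      -inner ℝ (σ.diracCurrent φ x) (W x X) := σ.mvfderiv_spinorInner_self_eq hφ hKilling
  refine ⟨⟨hsmooth, fun x ↦ ?_⟩, fun hU ↦ ?_, fun ⟨x₁, hx₁⟩ ↦ ?_⟩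
  · refine ext_inner_right ℝ fun X ↦ ?_
    rw [inner_riemannianGrad, hderiv, inner_neg_left, ContinuousLinearMap.adjoint_inner_left]
  · obtain ⟨x₀⟩ := ‹ConnectedSpace N›.toNonempty
    have hconst : ∀ x, f x - f x₀ = 0 := by
      have hd : MDifferentiable (𝓡 n) 𝓘(ℝ, ℝ) (fun x ↦ f x - f x₀) :=
        hdiff.sub mdifferentiable_const
      have hd0 : ∀ (x : N) (X : TangentSpace (𝓡 n) x),
          mvfderiv (𝓡 n) (fun x ↦ f x - f x₀) x X = 0 := by
        intro x X
        have h := mvfderiv_sub (hdiff x) (mdifferentiable_const (c := f x₀) x)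
        rw [show (fun x ↦ f x - f x₀) = f - fun _ ↦ f x₀ from rfl, h, mvfderiv_const, sub_zero,
          hderiv, hU, inner_zero_left, neg_zero]
      -- Grönwall with K = 0 says that a function with zero derivative is locally constant.
      have hclopen := isClopen_setOf_eq_zero_of_eventually hd.continuous fun x hx ↦
        eventually_eq_zero_of_abs_mvfderiv_le hd (K := 0) le_rfl
          (Filter.Eventually.of_forall fun y X ↦ by rw [hd0]; simp) hx
      have h := hclopen.eq_univ ⟨x₀, sub_self (f x₀)⟩
      exact fun x ↦ h.ge (Set.mem_univ x)
    refine ⟨√(f x₀), fun x ↦ ?_⟩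
    rw [SpinStructure.spinorNorm, ← sub_eq_zero.mp (hconst x)]
  · have hle : ∀ x, ‖σ.diracCurrent φ x‖ ≤ f x := fun x ↦ σ.norm_diracCurrent_le (hDirac x)
    have hclopen : IsClopen {x | f x = 0} := by
      refine isClopen_setOf_eq_zero_of_eventually hsmooth.continuous fun x hx ↦ ?_
      obtain ⟨K, hK0, hK⟩ := σ.eventually_norm_apply_le hW x
      refine eventually_eq_zero_of_abs_mvfderiv_le hdiff hK0 ?_ hx
      filter_upwards [hK] with y hy X
      -- Cauchy–Schwarz: |h(U, W X)| ≤ |U| |W X| ≤ f · K |X|.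
      rw [hderiv, abs_neg, mul_comm]
      exact (abs_real_inner_le_norm _ _).trans
        (mul_le_mul ((hle y).trans (le_abs_self _)) (hy X) (norm_nonneg _) (abs_nonneg _))
    have hf₁ : f x₁ ≠ 0 := ((norm_pos_iff.mpr hx₁).trans_le (hle x₁)).ne'
    have hne : ∀ x, f x ≠ 0 := by
      rcases isClopen_iff.mp hclopen with h | h
      · exact fun x hx ↦ (h.le hx : x ∈ (∅ : Set N))
      · exact absurd (h.ge (Set.mem_univ x₁)) hf₁
    have hφ0 : ∀ x, φ x ≠ 0 := fun x ↦
      mt (σ.re_spinorInner_self_eq_zero_iff φ x).mpr (hne x)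
    have hor : ∀ x, u x = 0 ∨ u x = f x := fun x ↦
      σ.eq_zero_or_eq_re_spinorInner_self (hDirac x) (hφ0 x)
    have huclopen : IsClopen {x | u x = f x} := by
      refine ⟨isClosed_eq hu.continuous hsmooth.continuous, ?_⟩
      -- As f has no zeros, the alternatives u = 0 and u = f exclude each other.
      have h : {x | u x = f x} = {x | u x = 0}ᶜ := by
        ext x
        refine ⟨fun h h' ↦ hne x (h.symm.trans h'), fun h ↦ (hor x).resolve_left h⟩
      rw [h]
      exact (isClosed_eq hu.continuous continuous_const).isOpen_compl
    have hu₁ : u x₁ = f x₁ := (hor x₁).resolve_left fun h ↦ hx₁ <| by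
      rw [← norm_eq_zero, σ.norm_diracCurrent_eq_abs (hDirac x₁) (hφ0 x₁), h, abs_zero]
    have huf : ∀ x, u x = f x := fun x ↦ (huclopen.eq_univ ⟨x₁, hu₁⟩).ge (Set.mem_univ x)
    have hnn : ∀ x, 0 ≤ f x := σ.re_spinorInner_self_nonneg φ
    have hUf : ∀ x, ‖σ.diracCurrent φ x‖ = f x := fun x ↦ by
      rw [σ.norm_diracCurrent_eq_abs (hDirac x) (hφ0 x), huf, abs_of_nonneg (hnn x)]
    refine ⟨fun x hx ↦ hne x ?_, hφ0, fun x ↦ ⟨(huf x).trans (hUf x).symm, ?_, ?_⟩⟩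
    · rw [← hUf, hx, norm_zero]
    · rw [hUf, hf]
      simp only [SpinStructure.spinorInner_self, Complex.ofReal_re]
    · rw [hUf, SpinStructure.spinorNorm, Real.sq_sqrt (hnn x)]
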